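/- All graphs are finite and simple. A graph is \emph{factorizable} if it has a perfect matching, and \emph{factor-critical} if for every vertex $v$ it has a matching covering exactly the vertices other than $v$. An edge of a graph $G$ is \emph{allowed} if some maximum matching of $G$ contains it; the \emph{factor-components} of $G$ are the induced subgraphs $G[C]$, where $C$ ranges over the vertex sets of the connected components of the spanning subgraph of $G$ formed by the allowed edges. Let $\mathcal{G}(G)$ be the set of factor-components of $G$. A set $X\subseteq V(G)$ is \emph{separating} if it is the union of the vertex sets of one or more factor-components. For $G_1,G_2\in\mathcal{G}(G)$ write $G_1\trianglelefteq G_2$ (the \emph{basilica order} of $G$) if there is a separating set $X$ with $V(G_1)\cup V(G_2)\subseteq X$ such that the graph $G[X]/G_1$, obtained from $G[X]$ by contracting $V(G_1)$ to a single vertex, is factor-critical. This relation is a partial order on $\mathcal{G}(G)$. \textbf{Theorem.} Let $G$ be a factorizable graph, and let $G_1,G_2\in\mathcal{G}(G)$ be such that $G_1\trianglelefteq G_2$ does not hold and $G_1$ is minimal in $(\mathcal{G}(G),\trianglelefteq)$, that is, the only $K\in\mathcal{G}(G)$ with $K\trianglelefteq G_1$ is $G_1$ itself. Then there are edges $e$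 and $f$ of the complement of $G$ (possibly $e=f$), each joining a vertex of $G_1$ to a vertex of $G_2$, such that $\mathcal{G}(G+e+f)=\mathcal{G}(G)$ and $G_1\trianglelefteq G_2$ holds in the basilica order of $G+e+f$. -/

import Mathlib

/-! Graphs are finite simple graphs on a vertex type `V`; a matching is a subgraph satisfying
Mathlib's `SimpleGraph.Subgraph.IsMatching`, and it covers exactly its vertices. -/

namespace Basilica

/-- A maximum matching: a matching with the greatest number of edges. -/
def IsMaximumMatching {V : Type*} {G : SimpleGraph V} (M : G.Subgraph) : Prop :=
  M.IsMatching ∧ ∀ N : G.Subgraph, N.IsMatching → N.edgeSet.ncard ≤ M.edgeSet.ncard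

/-- A graph is factorizable if it has a perfect matching. -/
def IsFactorizable {V : Type*} (G : SimpleGraph V) : Prop :=
  ∃ M : G.Subgraph, M.IsPerfectMatching

/-- A graph is factor-critical if, for every vertex `v`, there is a matching that covers all
vertices except `v`. -/
def IsFactorCritical {V : Type*} (G : SimpleGraph V) : Prop :=
  ∀ v : V, ∃ M : G.Subgraph, M.IsMatching ∧ M.verts = {v}ᶜ

/-- The spanning subgraph of `G` whose edges are the allowed ones, that is, those contained in
some maximum matching of `G`. -/
def allowedGraph {V : Type*} (G : SimpleGraph V) : SimpleGraph V where
  Adj u v := ∃ M : G.Subgraph, IsMaximumMatching M ∧ M.Adj u v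
  symm := ⟨fun _ _ ⟨M, hM, h⟩ => ⟨M, hM, h.symm⟩⟩
  loopless := ⟨fun _ ⟨_, _, h⟩ => h.ne rfl⟩

/-- The induced subgraph `G[C]`. It is regarded as a subgraph of the complete graph on `V`, so
that subgraphs of different graphs on `V` can be compared. -/
def inducedSubgraph {V : Type*} (G : SimpleGraph V) (C : Set V) :
    (⊤ : SimpleGraph V).Subgraph where
  verts := C
  Adj u v := u ∈ C ∧ v ∈ C ∧ G.Adj u v
  adj_sub h := h.2.2.ne
  edge_vert h := h.1
  symm := ⟨fun _ _ h => ⟨h.2.1, h.1, h.2.2.symm⟩⟩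

/-- The set of factor-components of `G`: the subgraphs of `G` induced by the vertex sets of the
connected components of the graph of allowed edges. -/
def factorComponents {V : Type*} (G : SimpleGraph V) : Set (⊤ : SimpleGraph V).Subgraph :=
  {H | ∃ c : (allowedGraph G).ConnectedComponent, H = inducedSubgraph G c.supp}

/-- The contraction `G / X`; the vertex into which `X` is contracted is `none`. Parallel edges are
identified, which does not affect which vertex sets are covered by matchings. -/
def contract {V : Type*} (G : SimpleGraph V) (X : Set V) :
    SimpleGraph (Option {v : V // v ∉ X}) where
  Adj
    | none, none => False
    | none, some v => ∃ x ∈ X, G.Adj x v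
    | some u, none => ∃ x ∈ X, G.Adj x u
    | some u, some v => G.Adj u v
  symm := ⟨by
    rintro (_ | u) (_ | v) h
    · exact h
    · exact h
    · exact h
    · exact SimpleGraph.Adj.symm (G := G) h⟩
  loopless := ⟨by
    rintro (_ | u) h
    · exact h
    · exact h.ne rfl⟩

/-- A set of vertices is separating if it is the union of the vertex sets of one or more
factor-components. -/
def IsSeparating {V : Type*} (G : SimpleGraph V) (X : Set V) : Prop :=
  ∃ F : Set (⊤ : SimpleGraph V).Subgraph,
    F ⊆ factorComponents G ∧ F.Nonempty ∧ X = ⋃ H ∈ F, H.verts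

/-- `X` is a critical-inducing set for `H₁` to `H₂`: it is separating, contains both vertex sets,
and `G[X] / H₁` is factor-critical. -/
def IsCriticalInducing {V : Type*} (G : SimpleGraph V) (H₁ H₂ : (⊤ : SimpleGraph V).Subgraph)
    (X : Set V) : Prop :=
  IsSeparating G X ∧ H₁.verts ∪ H₂.verts ⊆ X ∧
    IsFactorCritical (contract (G.induce X) (Subtype.val ⁻¹' H₁.verts))

/-- The basilica order: `H₁ ⊴ H₂` in `G`. -/
def Yields {V : Type*} (G : SimpleGraph V) (H₁ H₂ : (⊤ : SimpleGraph V).Subgraph) : Prop :=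
  ∃ X : Set V, IsCriticalInducing G H₁ H₂ X

/-- `H` is minimal among the factor-components of `G` for the basilica order: no other
factor-component lies below it. -/
def IsMinimalComponent {V : Type*} (G : SimpleGraph V) (H : (⊤ : SimpleGraph V).Subgraph) : Prop :=
  H ∈ factorComponents G ∧ ∀ K ∈ factorComponents G, Yields G K H → K = H

/-- `e` is an edge of the complement of `G` that joins a vertex of `H₁` to a vertex of `H₂`. -/
def IsComplementEdgeBetween {V : Type*} (G : SimpleGraph V)
    (H₁ H₂ : (⊤ : SimpleGraph V).Subgraph) (e : Sym2 V) : Prop :=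
  e ∈ Gᶜ.edgeSet ∧ ∃ x ∈ H₁.verts, ∃ y ∈ H₂.verts, e = s(x, y)

/-- The graph `G + F` obtained by adding a set `F` of edges. -/
def addEdges {V : Type*} (G : SimpleGraph V) (F : Set (Sym2 V)) : SimpleGraph V :=
  G ⊔ SimpleGraph.fromEdgeSet F

end Basilica

/-! Fix a perfect matching `m` of G. An ear relative to a factor-component K is an alternating walk,
possibly closed, that leaves K and returns to it by edges outside `m`; K lies below every
factor-component that an ear traverses (`yields_of_ear`). So for x in G₁ and y in G₂ the edges x y
and x (m y) put G₁ below G₂, by the ear x, y, m y, x. They do no harm if they lie in no perfect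
matching. Both contain x, so a perfect matching uses at most one of them, and its symmetric
difference with `m` would contain an alternating path of G from x to y or to m y that begins and
ends with edges of `m`. It remains to find x and y without such a path and to add whichever of the
two edges is missing.

Suppose that there is no such pair (`exists_not_altReach`). Some alternating path then leads from G₂
to G₁; keep the piece from its last vertex z in G₂ to its first vertex x in G₁, where it arrives
outside `m`. By minimality of G₁ no path from z arrives at x by an edge of `m`
(`not_altReach_of_altChain`): the two would form an ear through G₁ relative to another component, or
an alternating circuit joining two components. Hence such a path starts at m z. According to whether
and in which direction it meets the piece, there results an ear of G₁ through G₂, a violation of the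
same lemma at m z, or an alternating circuit through z and a later vertex of the piece. All three
are impossible. -/

namespace Basilica

open SimpleGraph

variable {V : Type*} {G : SimpleGraph V} {m n : Equiv.Perm V}

/-! ### Perfect matchings as involutions. -/

/-- A perfect matching, given by the involution that interchanges the ends of its edges. -/
def IsMatchingPerm (G : SimpleGraph V) (m : Equiv.Perm V) : Prop :=
  (∀ v, m (m v) = v) ∧ ∀ v, G.Adj v (m v)

theorem two_mul_ncard_edgeSet [Finite V] {M : G.Subgraph} (hM : M.IsMatching) :
    2 * M.edgeSet.ncard = M.verts.ncard := by
  classical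
  have := Fintype.ofFinite V
  have h := M.spanningCoe.sum_degrees_eq_twice_card_edges
  have hd : ∀ v, M.spanningCoe.degree v = if v ∈ M.verts then 1 else 0 := by
    intro v
    split_ifs with hv
    · rw [degree_eq_one_iff_existsUnique_adj]
      exact hM hv
    · rw [← Nat.lt_one_iff, Nat.lt_iff_add_one_le, Nat.succ_le_succ_iff, Nat.le_zero,
        degree_eq_zero]
      intro w hw
      exact hv (M.edge_vert hw)
  simp only [hd] at h
  rw [Finset.sum_boole] at h
  have h1 : M.edgeSet.ncard = M.spanningCoe.edgeFinset.card := by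
    rw [← Set.ncard_coe_finset, coe_edgeFinset]
    rfl
  have h2 : M.verts.ncard = (Finset.univ.filter (· ∈ M.verts)).card := by
    rw [← Set.ncard_coe_finset]
    congr 1
    ext v
    simp
  rw [h1, h2]
  exact_mod_cast h.symm

theorem isMaximumMatching_of_isPerfectMatching [Finite V] {M : G.Subgraph}
    (hM : M.IsPerfectMatching) : IsMaximumMatching M := by
  refine ⟨hM.1, fun N hN => ?_⟩
  have h1 := two_mul_ncard_edgeSet hM.1
  have h2 := two_mul_ncard_edgeSet hN
  have h3 : N.verts.ncard ≤ M.verts.ncard :=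
    Set.ncard_le_ncard (fun v _ => hM.2 v) (Set.toFinite _)
  omega

theorem IsMaximumMatching.isPerfectMatching [Finite V] {M : G.Subgraph}
    (hM : IsMaximumMatching M) (hG : IsFactorizable G) : M.IsPerfectMatching := by
  obtain ⟨N, hN⟩ := hG
  refine ⟨hM.1, ?_⟩
  have h1 := two_mul_ncard_edgeSet hM.1
  have h2 := two_mul_ncard_edgeSet hN.1
  have h3 := hM.2 N hN.1
  have h4 : M.verts = N.verts :=
    Set.eq_of_subset_of_ncard_le (fun v _ => hN.2 v) (by omega) (Set.toFinite _)
  intro v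
  rw [h4]
  exact hN.2 v

theorem exists_isMatchingPerm_of_isPerfectMatching {M : G.Subgraph} (hM : M.IsPerfectMatching) :
    ∃ m : Equiv.Perm V, IsMatchingPerm G m ∧ ∀ u v, M.Adj u v → m u = v := by
  rw [Subgraph.isPerfectMatching_iff] at hM
  choose f hf hu using hM
  have hff : Function.Involutive f := fun v => (hu _ _ (hf v).symm).symm
  exact ⟨hff.toPerm, ⟨hff, fun v => (hf v).adj_sub⟩, fun u v h => (hu u v h).symm⟩

/-- The perfect matching with edges `{v, m v}`. -/
def IsMatchingPerm.subgraph {m : Equiv.Perm V} (hm : IsMatchingPerm G m) : G.Subgraph where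
  verts := Set.univ
  Adj u v := m u = v
  adj_sub := by rintro u _ rfl; exact hm.2 u
  edge_vert _ := trivial
  symm := ⟨by rintro u _ rfl; exact hm.1 u⟩

theorem IsMatchingPerm.isPerfectMatching_subgraph {m : Equiv.Perm V} (hm : IsMatchingPerm G m) :
    hm.subgraph.IsPerfectMatching := by
  rw [Subgraph.isPerfectMatching_iff]
  exact fun v => ⟨m v, rfl, fun w h => (show m v = w from h).symm⟩

theorem IsMatchingPerm.isFactorizable {m : Equiv.Perm V} (hm : IsMatchingPerm G m) :
    IsFactorizable G :=
  ⟨_, hm.isPerfectMatching_subgraph⟩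

/-- In a factorizable graph the maximum matchings are exactly the perfect ones. -/
theorem allowedGraph_adj_iff [Finite V] (hG : IsFactorizable G) {u v : V} :
    (allowedGraph G).Adj u v ↔ ∃ m : Equiv.Perm V, IsMatchingPerm G m ∧ m u = v := by
  constructor
  · rintro ⟨M, hM, h⟩
    obtain ⟨m, hm, hm'⟩ := exists_isMatchingPerm_of_isPerfectMatching (hM.isPerfectMatching hG)
    exact ⟨m, hm, hm' u v h⟩
  · rintro ⟨m, hm, h⟩
    exact ⟨hm.subgraph, isMaximumMatching_of_isPerfectMatching hm.isPerfectMatching_subgraph, h⟩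

/-! ### Vertex sets of factor-components. -/

/-- The vertex set of the factor-component that contains `v`. -/
def componentOf (G : SimpleGraph V) (v : V) : Set V :=
  {u | (allowedGraph G).Reachable v u}

theorem mem_componentOf_self (v : V) : v ∈ componentOf G v := Reachable.refl v

theorem componentOf_eq_of_mem {u v : V} (h : u ∈ componentOf G v) :
    componentOf G u = componentOf G v := by
  ext w
  exact ⟨fun hw => Reachable.trans h hw, fun hw => (Reachable.symm h).trans hw⟩

theorem mem_factorComponents_iff {H : (⊤ : SimpleGraph V).Subgraph} :
    H ∈ factorComponents G ↔ ∃ v, H = inducedSubgraph G (componentOf G v) := by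
  have key : ∀ v, ((allowedGraph G).connectedComponentMk v).supp = componentOf G v := by
    intro v
    ext u
    rw [ConnectedComponent.mem_supp_iff, ConnectedComponent.eq]
    exact reachable_comm
  constructor
  · rintro ⟨c, rfl⟩
    induction c using ConnectedComponent.ind with
    | _ v => exact ⟨v, by rw [key]⟩
  · rintro ⟨v, rfl⟩
    exact ⟨(allowedGraph G).connectedComponentMk v, by rw [key]⟩

theorem IsMatchingPerm.apply_mem_componentOf [Finite V] {m : Equiv.Perm V}
    (hm : IsMatchingPerm G m) {u v : V} (h : u ∈ componentOf G v) : m u ∈ componentOf G v :=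
  Reachable.trans h ((allowedGraph_adj_iff hm.isFactorizable).2 ⟨m, hm, rfl⟩).reachable

theorem IsMatchingPerm.apply_mem_componentOf_iff [Finite V] {m : Equiv.Perm V}
    (hm : IsMatchingPerm G m) {u v : V} : m u ∈ componentOf G v ↔ u ∈ componentOf G v :=
  ⟨fun h => by simpa only [hm.1] using hm.apply_mem_componentOf h, hm.apply_mem_componentOf⟩

/-- A matching of the contraction uses at most one edge at the contracted vertex, so a single vertex
`g` of `H` can stand for it. When the contracted vertex itself is to be missed, `m` restricted to `X
\ H` serves. -/
theorem isFactorCritical_contract {X H : Set V} {m : Equiv.Perm V} (hm : IsMatchingPerm G m)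
    (hHX : H ⊆ X) (hHne : H.Nonempty) (hmX : ∀ v ∈ X \ H, m v ∈ X \ H)
    (h : ∀ w ∈ X \ H, ∃ g ∈ H, ∃ n : Equiv.Perm V, (∀ v, n (n v) = v) ∧
      ∀ v, (v ∈ X \ H ∨ v = g) → v ≠ w → G.Adj v (n v) ∧ (n v ∈ X \ H ∨ n v = g) ∧ n v ≠ w) :
    IsFactorCritical (contract (G.induce X) (Subtype.val ⁻¹' H)) := by
  have main : ∀ g ∈ H, ∀ n : Equiv.Perm V, (∀ v, n (n v) = v) →
      ∀ w : Option {v : X // v ∉ (Subtype.val ⁻¹' H : Set X)},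
      (∀ v, (v ∈ X \ H ∨ v = g) → v ≠ w.elim g (fun u => u.1.1) →
        G.Adj v (n v) ∧ (n v ∈ X \ H ∨ n v = g) ∧ n v ≠ w.elim g (fun u => u.1.1)) →
      ∃ M : (contract (G.induce X) (Subtype.val ⁻¹' H)).Subgraph,
        M.IsMatching ∧ M.verts = {w}ᶜ := by
    intro g hg n hn w hw
    set φ : Option {v : X // v ∉ (Subtype.val ⁻¹' H : Set X)} → V :=
      fun a => a.elim g (fun u => u.1.1) with hφ
    have hφi : Function.Injective φ := by
      rintro (_ | a) (_ | b) hab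
      · rfl
      · exact absurd (show b.1.1 ∈ H from (show g = b.1.1 from hab) ▸ hg) b.2
      · exact absurd (show a.1.1 ∈ H from (show a.1.1 = g from hab).symm ▸ hg) a.2
      · exact congrArg some (Subtype.ext (Subtype.ext hab))
    have hφm : ∀ a, φ a ∈ X \ H ∨ φ a = g := by
      rintro (_ | a)
      · exact Or.inr rfl
      · exact Or.inl ⟨a.1.2, a.2⟩
    have hφs : ∀ v, (v ∈ X \ H ∨ v = g) → ∃ a, φ a = v := by
      rintro v (hv | rfl)
      · exact ⟨some ⟨⟨v, hv.1⟩, hv.2⟩, rfl⟩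
      · exact ⟨none, rfl⟩
    have hadj : ∀ a b, G.Adj (φ a) (φ b) →
        (contract (G.induce X) (Subtype.val ⁻¹' H)).Adj a b := by
      rintro (_ | a) (_ | b) hab
      · exact (hab.ne rfl).elim
      · exact ⟨⟨g, hHX hg⟩, hg, hab⟩
      · exact ⟨⟨g, hHX hg⟩, hg, hab.symm⟩
      · exact hab
    refine ⟨{ verts := {w}ᶜ, Adj := fun a b => a ≠ w ∧ n (φ a) = φ b, adj_sub := ?_,
              edge_vert := fun h => h.1, symm := ⟨?_⟩ }, ?_, rfl⟩
    · rintro a b ⟨ha, hab⟩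
      apply hadj
      rw [← hab]
      exact (hw _ (hφm a) (fun h => ha (hφi h))).1
    · rintro a b ⟨ha, hab⟩
      refine ⟨fun h => (hw _ (hφm a) (fun h => ha (hφi h))).2.2 ?_, ?_⟩
      · rw [hab, h]
      · rw [← hab, hn]
    · intro a ha
      obtain ⟨b, hb⟩ := hφs _ (hw _ (hφm a) (fun h => ha (hφi h))).2.1
      exact ⟨b, ⟨ha, hb.symm⟩, fun c hc => hφi (hc.2.symm.trans hb.symm)⟩
  rintro (_ | w)
  · obtain ⟨g, hg⟩ := hHne
    refine main g hg m hm.1 none ?_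
    rintro v (hv | rfl) hvg
    · refine ⟨hm.2 v, Or.inl (hmX v hv), ?_⟩
      rintro h
      exact (hmX v hv).2 (h ▸ hg)
    · exact (hvg rfl).elim
  · obtain ⟨g, hg, n, hn, h'⟩ := h w.1.1 ⟨w.1.2, w.2⟩
    exact main g hg n hn (some w) h'

/-! ### Alternating paths as lists. -/

/-- The list `L` of vertices encodes the walk `v₁, m v₁, v₂, m v₂, …` of `G`, which alternates
between edges of the perfect matching `m` and arbitrary edges. -/
def AltChain (G : SimpleGraph V) (m : Equiv.Perm V) (L : List V) : Prop :=
  L.IsChain fun a b => G.Adj (m a) b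

/-- The matching edges at the vertices of the list `L` are pairwise distinct. -/
def AltSimple (m : Equiv.Perm V) (L : List V) : Prop :=
  L.Pairwise fun a b => a ≠ b ∧ a ≠ m b

/-- There is an alternating path from `a` to `m b` that begins and ends with matching edges. -/
def AltReach (G : SimpleGraph V) (m : Equiv.Perm V) (a b : V) : Prop :=
  ∃ L, AltChain G m L ∧ AltSimple m L ∧ L.head? = some a ∧ L.getLast? = some b

theorem exists_first {α : Type*} (p : α → Prop) {L : List α} (h : ∃ a ∈ L, p a) :
    ∃ A a B, L = A ++ a :: B ∧ p a ∧ ∀ b ∈ A, ¬ p b := by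
  induction L with
  | nil => simp at h
  | cons c L ih =>
    by_cases hc : p c
    · exact ⟨[], c, L, rfl, hc, by simp⟩
    · obtain ⟨A, a, B, rfl, ha, hA⟩ := ih (by simpa [hc] using h)
      exact ⟨c :: A, a, B, rfl, ha, by simpa [hc] using hA⟩

theorem exists_last {α : Type*} (p : α → Prop) {L : List α} (h : ∃ a ∈ L, p a) :
    ∃ A a B, L = A ++ a :: B ∧ p a ∧ ∀ b ∈ B, ¬ p b := by
  obtain ⟨A, a, B, hL, ha, hA⟩ := exists_first p (L := L.reverse) (by simpa using h)
  exact ⟨B.reverse, a, A.reverse, by simpa using congrArg List.reverse hL, ha, by simpa using hA⟩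

theorem AltChain.reverse (hm : ∀ v, m (m v) = v) {L : List V} (h : AltChain G m L) :
    AltChain G m (L.reverse.map m) := by
  unfold AltChain at *
  rw [List.isChain_map, List.isChain_reverse]
  refine h.imp fun a b hab => ?_
  rw [hm]
  exact hab.symm

theorem AltSimple.reverse (hm : ∀ v, m (m v) = v) {L : List V} (h : AltSimple m L) :
    AltSimple m (L.reverse.map m) := by
  unfold AltSimple at *
  rw [List.pairwise_map, List.pairwise_reverse]
  refine h.imp fun {a b} hab => ⟨fun h => hab.1 (m.injective h).symm, fun h => hab.2 ?_⟩
  rw [hm] at h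
  exact h.symm

theorem AltReach.reverse (hm : ∀ v, m (m v) = v) {a b : V} (h : AltReach G m a b) :
    AltReach G m (m b) (m a) := by
  obtain ⟨L, h1, h2, h3, h4⟩ := h
  exact ⟨_, h1.reverse hm, h2.reverse hm, by simp [h4], by simp [h3]⟩

/-- Switching `m` along the path frees its two ends `a` and `m l`. The involution `n` interchanges
them, so that {a, m l} is the only pair that need not be an edge. -/
theorem exists_perm_of_altChain [DecidableEq V] (hm : IsMatchingPerm G m) {L : List V} {a l : V}
    (hc : AltChain G m L) (hs : AltSimple m L) (ha : L.head? = some a)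
    (hl : L.getLast? = some l) :
    ∃ n : Equiv.Perm V, (∀ v, n (n v) = v) ∧ n a = m l ∧
      (∀ v, v ≠ a → v ≠ m l → G.Adj v (n v)) ∧
      (∀ v, v ∉ L → m v ∉ L → n v = m v) ∧ L.IsChain fun p q => n (m p) = q := by
  have hne : ∀ v, m v ≠ v := fun v => (hm.2 v).ne'
  induction L generalizing a with
  | nil => simp at ha
  | cons c L ih =>
    obtain rfl : c = a := by simpa using ha
    cases L with
    | nil =>
      obtain rfl : c = l := by simpa using hl
      exact ⟨m, hm.1, rfl, fun v _ _ => hm.2 v, fun v _ _ => rfl, by simp⟩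
    | cons b L =>
      have hc' : G.Adj (m c) b ∧ AltChain G m (b :: L) := List.isChain_cons_cons.1 hc
      have hs' := List.pairwise_cons.1 hs
      have hl' : (b :: L).getLast? = some l := by simpa using hl
      obtain ⟨n, h1, h2, h3, h4, h5⟩ := ih hc'.2 hs'.2 rfl hl'
      have hcb : c ≠ b := (hs'.1 b (by simp)).1
      have hcmb : c ≠ m b := (hs'.1 b (by simp)).2
      have hmcb : m c ≠ b := fun h => hcmb (by rw [← h, hm.1])
      have hlmem : l ∈ b :: L := List.mem_of_getLast? hl'
      have hmlc : m l ≠ c := fun h => (hs'.1 l hlmem).2 h.symm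
      have hmlb : m l ≠ b := by
        rcases List.mem_cons.1 hlmem with h | h
        · rw [h]
          exact hne b
        · exact fun h' => ((List.pairwise_cons.1 hs'.2).1 l h).2 h'.symm
      have hnc : n c = m c := h4 c (fun h => (hs'.1 c h).1 rfl)
        (fun h => (hs'.1 _ h).2 (hm.1 c).symm)
      have hnmc : n (m c) = c := by rw [← hnc, h1]
      -- The involution `n` for the tail pairs `b` with `m l` and still pairs `c` with `m c`.
      -- Conjugation by the transposition of `c` and `b` pairs `c` with `m l` and `b` with `m c`.
      have e1 : (Equiv.swap c b * n * Equiv.swap c b) c = m l := by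
        simp [h2, Equiv.swap_apply_of_ne_of_ne hmlc hmlb]
      have e2 : (Equiv.swap c b * n * Equiv.swap c b) b = m c := by
        simp [hnc, Equiv.swap_apply_of_ne_of_ne (hne c) hmcb]
      have e3 : (Equiv.swap c b * n * Equiv.swap c b) (m c) = b := by
        simp [hnmc, Equiv.swap_apply_of_ne_of_ne (hne c) hmcb]
      have e4 : ∀ v, v ≠ c → v ≠ b → v ≠ m c → v ≠ m l →
          (Equiv.swap c b * n * Equiv.swap c b) v = n v := by
        intro v hvc hvb hvmc hvml
        have i1 : n v ≠ c := fun h => hvmc (by rw [← h1 v, h, hnc])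
        have i2 : n v ≠ b := fun h => hvml (by rw [← h1 v, h, h2])
        simp [Equiv.swap_apply_of_ne_of_ne hvc hvb, Equiv.swap_apply_of_ne_of_ne i1 i2]
      refine ⟨Equiv.swap c b * n * Equiv.swap c b, ?_, e1, ?_, ?_, ?_⟩
      · intro v
        simp [h1]
      · intro v hvc hvml
        by_cases hvb : v = b
        · subst hvb
          rw [e2]
          exact hc'.1.symm
        by_cases hvmc : v = m c
        · rw [hvmc, e3]
          exact hc'.1
        rw [e4 v hvc hvb hvmc hvml]
        exact h3 v hvb hvml
      · intro v hv hmv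
        have hv' : v ≠ c ∧ v ∉ b :: L := not_or.1 fun h => hv (List.mem_cons.2 h)
        have hmv' : m v ≠ c ∧ m v ∉ b :: L := not_or.1 fun h => hmv (List.mem_cons.2 h)
        rw [e4 v hv'.1 (fun h => hv'.2 (by simp [h])) (fun h => hmv'.1 (by rw [h, hm.1]))
          (fun h => hmv'.2 (by rw [h, hm.1]; exact hlmem))]
        exact h4 v hv'.2 hmv'.2
      · refine List.isChain_cons_cons.2 ⟨e3, h5.imp_of_mem_tail_imp fun p q hp hq hpq => ?_⟩
        have hpc := hs'.1 p hp
        have hqb := (List.pairwise_cons.1 hs'.2).1 q hq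
        have hqc := hs'.1 q (by simp at hq; simp [hq])
        have i1 : m p ≠ c := fun h => hpc.2 h.symm
        have i2 : m p ≠ b := by
          rcases List.mem_cons.1 hp with h | h
          · rw [h]
            exact hne b
          · exact fun h' => ((List.pairwise_cons.1 hs'.2).1 p h).2 h'.symm
        have i3 : m p ≠ m c := fun h => hpc.1 (m.injective h).symm
        have i4 : m p ≠ m l := by
          intro h
          rw [h, ← h2, h1] at hpq
          exact hqb.1 hpq
        rw [e4 _ i1 i2 i3 i4, hpq]

/-! ### Symmetric differences as orbits of `n * m`. -/

/-- On a circuit of the union of two matchings, `n * m` moves two steps at a time, so one orbit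
contains one end of each `m`-edge. Formally, `m` inverts `n * m` by conjugation; if `m q` were the
k-th iterate of `q`, then `m` (k even) or `n` (k odd) would have a fixed point halfway. -/
theorem not_sameCycle_apply (hm : ∀ v, m (m v) = v) (hn : ∀ v, n (n v) = v)
    (hm' : ∀ v, m v ≠ v) (hn' : ∀ v, n v ≠ v) (q : V) : ¬ (n * m).SameCycle q (m q) := by
  have hmm : m * m = 1 := Equiv.ext hm
  have hnn : n * n = 1 := Equiv.ext hn
  have hmi : m⁻¹ = m := inv_eq_of_mul_eq_one_left hmm
  have hni : n⁻¹ = n := inv_eq_of_mul_eq_one_left hnn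
  have hconj : ∀ k : ℤ, m * (n * m) ^ k * m = (n * m) ^ (-k) := by
    intro k
    have h := conj_zpow (i := k) (a := m) (b := n * m)
    rw [hmi] at h
    rw [← h, zpow_neg, ← inv_zpow, mul_inv_rev, hmi, hni]
    simp only [mul_assoc, hmm, mul_one]
  rintro ⟨k, hk⟩
  rcases Int.even_or_odd' k with ⟨j, rfl | rfl⟩
  · apply hm' (((n * m) ^ j) q)
    have h1 := congrArg (fun f : Equiv.Perm V => f (m q)) (hconj (j))
    simp only [Equiv.Perm.mul_apply, hm] at h1
    change m (((n * m) ^ j) q) = _ at h1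
    rw [h1, ← hk, ← Equiv.Perm.mul_apply, ← zpow_add]
    congr 2
    ring
  · apply hn' (m (((n * m) ^ j) q))
    have h1 := congrArg (fun f : Equiv.Perm V => f (m q)) (hconj (j + 1))
    simp only [Equiv.Perm.mul_apply, hm] at h1
    rw [← hk, ← Equiv.Perm.mul_apply ((n * m) ^ (-(j + 1))), ← zpow_add] at h1
    have h2 : n (m (((n * m) ^ j) q)) = ((n * m) ^ (j + 1)) q := by
      rw [add_comm, zpow_add, zpow_one]
      rfl
    rw [h2]
    have h3 : -(j + 1) + (2 * j + 1) = j := by ring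
    rw [h3] at h1
    rw [← h1, hm]

theorem exists_orbit_list [Finite V] (hm : ∀ v, m (m v) = v) (hn : ∀ v, n (n v) = v)
    (hm' : ∀ v, m v ≠ v) (hn' : ∀ v, n v ≠ v) {q t : V} (h : (n * m).SameCycle q t) :
    ∃ L : List V, L.head? = some q ∧ L.getLast? = some t ∧ AltSimple m L ∧
      (∀ a ∈ L, (n * m).SameCycle q a) ∧ L.IsChain fun a b => b = n (m a) ∧ a ≠ t := by
  classical
  have hex : ∃ k : ℕ, ((n * m) ^ k) q = t := by
    obtain ⟨k, -, hk⟩ := h.exists_pow_eq'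
    exact ⟨k, hk⟩
  obtain ⟨k, hk, hmin⟩ : ∃ k : ℕ, ((n * m) ^ k) q = t ∧ ∀ i < k, ((n * m) ^ i) q ≠ t :=
    ⟨Nat.find hex, Nat.find_spec hex, fun i hi => Nat.find_min hex hi⟩
  have hsc : ∀ i : ℕ, (n * m).SameCycle q (((n * m) ^ i) q) :=
    fun i => ⟨i, by rw [zpow_natCast]⟩
  refine ⟨(List.range (k + 1)).map fun i => ((n * m) ^ i) q, ?_, ?_, ?_, ?_, ?_⟩
  · simp [List.range_succ_eq_map]
  · simp [List.range_succ, hk]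
  · unfold AltSimple
    rw [List.pairwise_map]
    refine List.pairwise_lt_range.imp_of_mem fun {i j} hi hj hij => ⟨fun he => ?_, fun he => ?_⟩
    -- A repetition at steps i < j would bring the orbit to `t` after k - j + i < k steps.
    · have hj' : j ≤ k := Nat.lt_succ_iff.1 (List.mem_range.1 hj)
      refine hmin (k - j + i) (by omega) ?_
      rw [pow_add, Equiv.Perm.mul_apply, he, ← Equiv.Perm.mul_apply, ← pow_add,
        Nat.sub_add_cancel hj', hk]
    · refine not_sameCycle_apply hm hn hm' hn' (((n * m) ^ j) q) ?_
      rw [← he]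
      exact (hsc j).symm.trans (hsc i)
  · intro a ha
    obtain ⟨i, -, rfl⟩ := List.mem_map.1 ha
    exact hsc i
  · rw [List.isChain_map, List.isChain_range_succ]
    intro i hi
    exact ⟨by rw [Nat.succ_eq_add_one, pow_succ']; rfl, hmin i hi⟩

/-- The circuit of `m` and `n` through the pair {x, y}, with that pair removed, is the required
path; all its other `n`-edges belong to `G`. -/
theorem altReach_of_perm [Finite V] (hm : IsMatchingPerm G m) (hn : ∀ v, n (n v) = v) {x y : V}
    (hxy : n x = y) (hne : x ≠ y) (hadj : ∀ v, v ≠ x → v ≠ y → G.Adj v (n v)) :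
    AltReach G m x (m y) := by
  have hm' : ∀ v, m v ≠ v := fun v => (hm.2 v).ne'
  have hyx : n y = x := by rw [← hxy, hn]
  have hn' : ∀ v, n v ≠ v := by
    intro v
    by_cases h1 : v = x
    · rw [h1, hxy]
      exact hne.symm
    by_cases h2 : v = y
    · rw [h2, hyx]
      exact hne
    exact (hadj v h1 h2).ne'
  have hsc : (n * m).SameCycle (m y) x := ⟨1, by simp [hm.1, hyx]⟩
  obtain ⟨L, h1, h2, h3, h4, h5⟩ := exists_orbit_list hm.1 hn hm' hn' hsc.symm
  refine ⟨L, h5.imp_of_mem_imp fun a b ha hb hab => ?_, h3, h1, h2⟩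
  rw [hab.1]
  refine hadj _ (fun h => ?_) (fun h => hab.2 (by rw [← h, hm.1]))
  refine not_sameCycle_apply hm.1 hn hm' hn' a ?_
  rw [h]
  exact (h4 a ha).symm

/-- Switching along an alternating circuit gives another perfect matching, so every edge of the
circuit is allowed. -/
theorem mem_componentOf_of_closed [Finite V] (hm : IsMatchingPerm G m) {c : V} {L : List V}
    (hc : AltChain G m (c :: L ++ [c])) (hs : AltSimple m (c :: L)) {v : V} (hv : v ∈ L) :
    v ∈ componentOf G c := by
  classical
  have hne : c :: L ≠ [] := by simp
  obtain ⟨hc1, -, hlast⟩ := List.isChain_append.1 hc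
  obtain ⟨n, h1, h2, h3, -, h5⟩ := exists_perm_of_altChain hm hc1 hs rfl
    (List.getLast?_eq_some_getLast hne)
  set l := (c :: L).getLast hne
  have hadj : G.Adj (m l) c := hlast l (by simp [l, List.getLast?_eq_some_getLast]) c (by simp)
  have hn : IsMatchingPerm G n := by
    refine ⟨h1, fun v => ?_⟩
    by_cases hvc : v = c
    · rw [hvc, h2]
      exact hadj.symm
    by_cases hvl : v = m l
    · rw [hvl, ← h2, h1, h2]
      exact hadj
    exact h3 v hvc hvl
  have h6 : (c :: L).IsChain fun p q => p ∈ componentOf G c → q ∈ componentOf G c :=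
    h5.imp fun p q (hpq : n (m p) = q) hp => by
      rw [← hpq]
      exact hn.apply_mem_componentOf (hm.apply_mem_componentOf hp)
  have key : ∀ (L : List V) (c' : V), c' ∈ componentOf G c →
      ((c' :: L).IsChain fun p q => p ∈ componentOf G c → q ∈ componentOf G c) →
      ∀ v ∈ L, v ∈ componentOf G c := by
    intro L
    induction L with
    | nil => simp
    | cons d L ih =>
      intro c' hc' hch v hv
      obtain ⟨h, hch'⟩ := List.isChain_cons_cons.1 hch
      rcases List.mem_cons.1 hv with rfl | hv
      · exact h hc'
      · exact ih d (h hc') hch' v hv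
  exact key L c (mem_componentOf_self c) h6 v hv

theorem sameCycle_apply_apply (hm : ∀ v, m (m v) = v) (hn : ∀ v, n (n v) = v) {a b : V} :
    (n * m).SameCycle (m a) (m b) ↔ (n * m).SameCycle a b := by
  have hmi : m⁻¹ = m := inv_eq_of_mul_eq_one_left (Equiv.ext hm)
  have hni : n⁻¹ = n := inv_eq_of_mul_eq_one_left (Equiv.ext hn)
  have h : m * (n * m)⁻¹ * m⁻¹ = n * m := by
    rw [mul_inv_rev, hmi, hni]
    ext v
    simp [hm]
  conv_lhs => rw [← h]
  rw [Equiv.Perm.sameCycle_conj, Equiv.Perm.sameCycle_inv, hmi, hm, hm]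

theorem altSimple_append {A B : List V} :
    AltSimple m (A ++ B) ↔ AltSimple m A ∧ AltSimple m B ∧ ∀ a ∈ A, ∀ b ∈ B, a ≠ b ∧ a ≠ m b :=
  List.pairwise_append

theorem altSimple_cons {a : V} {L : List V} :
    AltSimple m (a :: L) ↔ (∀ b ∈ L, a ≠ b ∧ a ≠ m b) ∧ AltSimple m L :=
  List.pairwise_cons

theorem mem_map_reverse_iff (hm : ∀ v, m (m v) = v) {A : List V} {v : V} :
    v ∈ A.reverse.map m ↔ m v ∈ A := by
  simp only [List.mem_map, List.mem_reverse]
  constructor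
  · rintro ⟨u, hu, rfl⟩
    rwa [hm]
  · exact fun h => ⟨m v, h, hm v⟩

theorem altChain_split {A B : List V} {c : V} :
    AltChain G m (A ++ c :: B) ↔ AltChain G m (A ++ [c]) ∧ AltChain G m (c :: B) :=
  List.isChain_split

theorem AltChain.of_append_left {A B : List V} (h : AltChain G m (A ++ B)) : AltChain G m A :=
  (List.isChain_append.1 h).1

theorem AltChain.of_append_right {A B : List V} (h : AltChain G m (A ++ B)) : AltChain G m B :=
  (List.isChain_append.1 h).2.1

/-! ### Alternating paths inside a factor-component, and ears. -/

/-- In a factor-component every vertex is met by an alternating path that starts at a given vertex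
with a matching edge. -/
theorem exists_altChain_of_mem_componentOf [Finite V] (hm : IsMatchingPerm G m) {w x : V}
    (hx : x ∈ componentOf G w) :
    ∃ L, AltChain G m L ∧ AltSimple m L ∧ L.head? = some w ∧ (∀ a ∈ L, a ∈ componentOf G w) ∧
      ∃ a ∈ L, x = a ∨ x = m a := by
  have hx' := (reachable_iff_reflTransGen _ _).1 (show (allowedGraph G).Reachable w x from hx)
  induction hx' with
  | refl =>
    exact ⟨[w], List.isChain_singleton _, List.pairwise_singleton _ _, rfl,
      by simpa using mem_componentOf_self w, w, by simp⟩
  | @tail r s hr hrs ih =>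
    obtain ⟨L, hc, hs, hw, hL, a, ha, har⟩ := ih ((reachable_iff_reflTransGen _ _).2 hr)
    obtain ⟨n, hn, hns⟩ := (allowedGraph_adj_iff hm.isFactorizable).1 hrs
    -- The allowed edge rs lies in a perfect matching `n`. The path to r is cut where it first meets
    -- the circuit of `m` and `n` through r, and then continued around that circuit, which also
    -- contains s. The circuit consists of two orbits, interchanged by `m`; hence the disjunction.
    obtain ⟨A, q, B, rfl, hq, hA⟩ := exists_first
      (fun v => (n * m).SameCycle r v ∨ (n * m).SameCycle r (m v)) (L := L) ⟨a, ha, by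
        rcases har with rfl | rfl
        · exact Or.inl (Equiv.Perm.SameCycle.refl _ _)
        · exact Or.inr (Equiv.Perm.SameCycle.refl _ _)⟩
    obtain ⟨t, ht, hqt⟩ : ∃ t, (s = t ∨ s = m t) ∧ (n * m).SameCycle q t := by
      rcases hq with hq | hq
      · refine ⟨m s, Or.inr (hm.1 s).symm, hq.symm.trans (Equiv.Perm.SameCycle.symm ⟨1, ?_⟩)⟩
        rw [zpow_one, Equiv.Perm.mul_apply, hm.1, ← hns, hn.1]
      · refine ⟨s, Or.inl rfl, ?_⟩
        have h1 := (sameCycle_apply_apply hm.1 hn.1).2 hq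
        rw [hm.1] at h1
        refine h1.symm.trans ⟨1, ?_⟩
        rw [zpow_one, Equiv.Perm.mul_apply, hm.1, hns]
    obtain ⟨O, hO1, hO2, hO3, hO4, hO5⟩ := exists_orbit_list hm.1 hn.1
      (fun v => (hm.2 v).ne') (fun v => (hn.2 v).ne') hqt
    have hqw : q ∈ componentOf G w := hL q (by simp)
    refine ⟨A ++ O, ?_, ?_, ?_, ?_, t, ?_, ht⟩
    · refine List.isChain_append.2 ⟨hc.of_append_left, hO5.imp fun a b hab => ?_, ?_⟩
      · rw [hab.1]
        exact hn.2 _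
      · intro u hu v hv
        rw [hO1] at hv
        exact (List.isChain_append.1 hc).2.2 u hu v (by simpa using hv)
    · refine altSimple_append.2 ⟨(altSimple_append.1 hs).1, hO3, fun u hu b hb => ?_⟩
      have h1 := hO4 b hb
      have h2 := (sameCycle_apply_apply hm.1 hn.1).2 h1
      have h3 := hA u hu
      constructor
      · rintro rfl
        exact h3 (hq.imp (fun h => h.trans h1) (fun h => h.trans h2))
      · rintro rfl
        rw [hm.1] at h3
        exact h3 (hq.symm.imp (fun h => h.trans h2) (fun h => h.trans h1))
    · cases A with
      | nil =>
        rw [List.nil_append, hO1]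
        simpa using hw
      | cons c A => simpa using hw
    · intro b hb
      rcases List.mem_append.1 hb with hb' | hb'
      · exact hL b (by simp [hb'])
      · obtain ⟨i, -, rfl⟩ := (hO4 b hb').exists_pow_eq'
        clear hb hb'
        induction i with
        | zero => exact hqw
        | succ i ih =>
          rw [pow_succ', Equiv.Perm.mul_apply]
          exact hn.apply_mem_componentOf (hm.apply_mem_componentOf ih)
    · exact List.mem_append_right _ (List.mem_of_getLast? hO2)

/-- An alternating path that reaches an ear `E` relative to `K` can be continued along the ear in
one of the two directions until it reaches `K`. -/
theorem exists_altChain_append_of_ear (hm : ∀ v, m (m v) = v) {K : Set V} {E A : List V}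
    {g₁ g₂ q : V} (hg₁ : g₁ ∈ K) (hg₂ : g₂ ∈ K) (hc : AltChain G m (m g₁ :: E ++ [g₂]))
    (hs : AltSimple m E) (hAc : AltChain G m (A ++ [q])) (hAs : AltSimple m A)
    (hA : ∀ a ∈ A, a ∉ E ∧ m a ∉ E) (hq : q ∈ E ∨ m q ∈ E) :
    ∃ P g, g ∈ K ∧ AltChain G m (A ++ q :: P ++ [g]) ∧ AltSimple m (A ++ q :: P) ∧
      ∀ p ∈ q :: P, p ∈ E ∨ m p ∈ E := by
  have half : ∀ (E : List V) (g₁ g₂ : V), g₂ ∈ K → AltChain G m (m g₁ :: E ++ [g₂]) →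
      AltSimple m E → (∀ a ∈ A, a ∉ E ∧ m a ∉ E) → q ∈ E →
      ∃ P g, g ∈ K ∧ AltChain G m (A ++ q :: P ++ [g]) ∧ AltSimple m (A ++ q :: P) ∧
        ∀ p ∈ q :: P, p ∈ E := by
    intro E g₁ g₂ hg₂ hc hs hA hq
    obtain ⟨E₁, E₂, rfl⟩ := List.append_of_mem hq
    refine ⟨E₂, g₂, hg₂, ?_, ?_, fun p hp => List.mem_append_right _ hp⟩
    · have h1 : AltChain G m ((m g₁ :: E₁) ++ (q :: (E₂ ++ [g₂]))) := by simpa using hc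
      simpa using altChain_split.2 ⟨hAc, h1.of_append_right⟩
    · refine altSimple_append.2 ⟨hAs, (altSimple_append.1 hs).2.1, fun a ha b hb => ?_⟩
      have h1 := hA a ha
      constructor
      · rintro rfl
        exact h1.1 (List.mem_append_right _ hb)
      · rintro rfl
        rw [hm] at h1
        exact h1.2 (List.mem_append_right _ hb)
  rcases hq with hq | hq
  · obtain ⟨P, g, h1, h2, h3, h4⟩ := half E g₁ g₂ hg₂ hc hs hA hq
    exact ⟨P, g, h1, h2, h3, fun p hp => Or.inl (h4 p hp)⟩
  · obtain ⟨P, g, h1, h2, h3, h4⟩ := half (E.reverse.map m) g₂ g₁ hg₁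
      (by simpa [hm] using hc.reverse hm) (hs.reverse hm)
      (fun a ha => by
        rw [mem_map_reverse_iff hm, mem_map_reverse_iff hm, hm]
        exact (hA a ha).symm) ((mem_map_reverse_iff hm).2 hq)
    exact ⟨P, g, h1, h2, h3, fun p hp => Or.inr ((mem_map_reverse_iff hm).1 (h4 p hp))⟩

/-- The given ear may revisit `K`; the new one is its portion around `e`, from the last visit to `K`
before `e` to the first visit after it. -/
theorem exists_ear_disjoint {K : Set V} (hK : ∀ v ∈ K, m v ∈ K) (hm : ∀ v, m (m v) = v)
    {E : List V} {g₁ g₂ e : V} (hg₁ : g₁ ∈ K) (hg₂ : g₂ ∈ K)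
    (hc : AltChain G m (m g₁ :: E ++ [g₂])) (hs : AltSimple m E) (he : e ∈ E) (heK : e ∉ K) :
    ∃ E' g₁' g₂', g₁' ∈ K ∧ g₂' ∈ K ∧ AltChain G m (m g₁' :: E' ++ [g₂']) ∧ AltSimple m E' ∧
      e ∈ E' ∧ ∀ v ∈ E', v ∉ K := by
  obtain ⟨E₁, E₂, rfl⟩ := List.append_of_mem he
  obtain ⟨B₁, k, B₂, h1, hk, hB⟩ := exists_last (· ∈ K) (L := m g₁ :: E₁)
    ⟨m g₁, by simp, hK _ hg₁⟩
  obtain ⟨C₁, k', C₂, h2, hk', hC⟩ := exists_first (· ∈ K) (L := E₂ ++ [g₂])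
    ⟨g₂, by simp, hg₂⟩
  have h3 : m g₁ :: (E₁ ++ e :: E₂) ++ [g₂] = B₁ ++ ((k :: (B₂ ++ e :: C₁) ++ [k']) ++ C₂) := by
    calc m g₁ :: (E₁ ++ e :: E₂) ++ [g₂] = (m g₁ :: E₁) ++ e :: (E₂ ++ [g₂]) := by simp
      _ = _ := by
        rw [h1, h2]
        simp
  rw [h3] at hc
  refine ⟨B₂ ++ e :: C₁, m k, k', hK k hk, hk', ?_, ?_, by simp, ?_⟩
  · rw [hm]
    exact hc.of_append_right.of_append_left
  · have hB₂ : B₂.Sublist E₁ := by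
      cases B₁ with
      | nil =>
        rw [List.nil_append, List.cons.injEq] at h1
        rw [h1.2]
      | cons b B₁ =>
        rw [List.cons_append, List.cons.injEq] at h1
        rw [h1.2]
        exact ((List.sublist_cons_self k B₂).trans (List.sublist_append_right _ _))
    have hC₁ : C₁.Sublist E₂ := by
      rcases List.eq_nil_or_concat C₂ with rfl | ⟨C₃, c, rfl⟩
      · rw [(List.append_inj' h2 rfl).1]
      · have h4 : E₂ ++ [g₂] = (C₁ ++ k' :: C₃) ++ [c] := by simpa using h2
        rw [(List.append_inj' h4 rfl).1]
        exact List.sublist_append_left _ _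
    exact List.Pairwise.sublist (hB₂.append (hC₁.cons_cons e)) hs
  · intro v hv
    rcases List.mem_append.1 hv with hv | hv
    · exact hB v hv
    · rcases List.mem_cons.1 hv with rfl | hv
      · exact heK
      · exact hC v hv

/-- A factor-component lies below every factor-component that is traversed by an ear relative to
it. -/
theorem yields_of_ear [Finite V] (hm : IsMatchingPerm G m) {k : V} {E : List V} {g₁ g₂ e : V}
    (hg₁ : g₁ ∈ componentOf G k) (hg₂ : g₂ ∈ componentOf G k)
    (hc : AltChain G m (m g₁ :: E ++ [g₂])) (hs : AltSimple m E) (he : e ∈ E)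
    (heK : e ∉ componentOf G k) :
    Yields G (inducedSubgraph G (componentOf G k)) (inducedSubgraph G (componentOf G e)) := by
  classical
  obtain ⟨E', g₁', g₂', hg₁', hg₂', hc', hs', he', hE'⟩ := exists_ear_disjoint
    (fun v => hm.apply_mem_componentOf) hm.1 hg₁ hg₂ hc hs he heK
  clear hc hs he hg₁ hg₂
  set K := componentOf G k with hKdef
  have hdisj : ∀ a, a ∉ K → ∀ v, v ∈ componentOf G a → v ∉ K := by
    intro a ha v hv hvK
    apply ha
    rw [hKdef, ← componentOf_eq_of_mem hvK, componentOf_eq_of_mem hv]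
    exact mem_componentOf_self a
  -- The critical-inducing set is `K` together with all factor-components that the shortened ear
  -- meets.
  set X : Set V := {v | v ∈ K ∨ ∃ a ∈ E', v ∈ componentOf G a} with hX
  have hXK : ∀ v, v ∈ X \ K ↔ ∃ a ∈ E', v ∈ componentOf G a := by
    intro v
    constructor
    · rintro ⟨h | h, hv⟩
      · exact (hv h).elim
      · exact h
    · rintro ⟨a, ha, hv⟩
      exact ⟨Or.inr ⟨a, ha, hv⟩, hdisj a (hE' a ha) v hv⟩
  have hXm : ∀ v, m v ∈ X \ K ↔ v ∈ X \ K := by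
    intro v
    simp only [hXK, hm.apply_mem_componentOf_iff]
  have hcrit : ∀ w ∈ X \ K, ∃ g ∈ K, ∃ n : Equiv.Perm V, (∀ v, n (n v) = v) ∧
      ∀ v, (v ∈ X \ K ∨ v = g) → v ≠ w → G.Adj v (n v) ∧ (n v ∈ X \ K ∨ n v = g) ∧ n v ≠ w := by
    intro w hw
    obtain ⟨a, ha, hwa⟩ := (hXK w).1 hw
    have haw : a ∈ componentOf G w := by
      rw [componentOf_eq_of_mem hwa]
      exact mem_componentOf_self a
    -- From `w` an alternating path runs inside its component to the ear, and then along the ear to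
    -- a vertex `g` of `K`.
    obtain ⟨L, hLc, hLs, hLw, hLm, b, hb, hab⟩ := exists_altChain_of_mem_componentOf hm haw
    obtain ⟨A, q, B, rfl, hq, hA⟩ := exists_first (fun v => v ∈ E' ∨ m v ∈ E') (L := L) ⟨b, hb, by
      rcases hab with rfl | rfl
      · exact Or.inl ha
      · exact Or.inr ha⟩
    obtain ⟨P, g, hg, hPc, hPs, hP⟩ := exists_altChain_append_of_ear (A := A) hm.1 hg₁' hg₂' hc' hs'
      (altChain_split.1 hLc).1 (altSimple_append.1 hLs).1 (fun v hv => not_or.1 (hA v hv)) hq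
    have hmem : ∀ p ∈ A ++ q :: P, p ∈ X \ K := by
      intro p hp
      rw [hXK]
      rcases List.mem_append.1 hp with hp | hp
      · refine ⟨a, ha, ?_⟩
        rw [← componentOf_eq_of_mem hwa]
        exact hLm p (List.mem_append_left _ hp)
      · rcases hP p hp with h | h
        · exact ⟨p, h, mem_componentOf_self p⟩
        · exact ⟨m p, h, hm.apply_mem_componentOf_iff.1 (mem_componentOf_self _)⟩
    have hmg : m g ∈ K := hm.apply_mem_componentOf hg
    have hsimple : AltSimple m (A ++ q :: P ++ [g]) := by
      refine altSimple_append.2 ⟨hPs, List.pairwise_singleton _ _, fun p hp r hr => ?_⟩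
      obtain rfl : r = g := by simpa using hr
      constructor
      · rintro rfl
        exact (hmem _ hp).2 hg
      · rintro rfl
        exact (hmem _ hp).2 hmg
    have hhead : (A ++ q :: P ++ [g]).head? = some w := by
      cases A with
      | nil => simpa using hLw
      | cons c A => simpa using hLw
    -- The path is prolonged by the matching edge from `g` to `m g`. Switching then leaves exactly
    -- `w` and `m g` free, and `m g` lies in `K`, outside the set to be matched, while `g` plays the
    -- contracted vertex.
    obtain ⟨n, hn1, hn2, hn3, hn4, -⟩ := exists_perm_of_altChain hm hPc hsimple hhead
      List.getLast?_concat
    have hnmg : n (m g) = w := by rw [← hn2, hn1]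
    refine ⟨g, hg, n, hn1, fun v hv hvw => ?_⟩
    have hvmg : v ≠ m g := by
      rintro rfl
      rcases hv with hv | hv
      · exact hv.2 hmg
      · exact (hm.2 g).ne' hv
    have hnvw : n v ≠ w := fun h => hvmg (by rw [← hn2, ← h, hn1])
    refine ⟨hn3 v hvw hvmg, ?_, hnvw⟩
    have hnvg : n v ≠ m g := fun h => hvw (by rw [← hnmg, ← h, hn1])
    have hg' : g ∈ A ++ q :: P ++ [g] := by simp
    by_cases h1 : n v ∈ A ++ q :: P ++ [g]
    · rcases List.mem_append.1 h1 with h | h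
      · exact Or.inl (hmem _ h)
      · exact Or.inr (by simpa using h)
    by_cases h2 : m (n v) ∈ A ++ q :: P ++ [g]
    · rcases List.mem_append.1 h2 with h | h
      · exact Or.inl ((hXm _).1 (hmem _ h))
      · exact (hnvg (by rw [← List.mem_singleton.1 h, hm.1])).elim
    have h3 : n v = m v := by
      have := hn4 _ h1 h2
      rw [hn1] at this
      rw [this, hm.1]
      exact congrArg n this.symm
    rw [h3]
    rcases hv with hv | rfl
    · exact Or.inl ((hXm v).2 hv)
    · rw [h3, hm.1] at h2
      exact (h2 hg').elim
  refine ⟨X, ⟨{H | ∃ v ∈ X, H = inducedSubgraph G (componentOf G v)}, ?_, ?_, ?_⟩, ?_, ?_⟩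
  · rintro H ⟨v, -, rfl⟩
    exact mem_factorComponents_iff.2 ⟨v, rfl⟩
  · exact ⟨_, e, Or.inr ⟨e, he', mem_componentOf_self e⟩, rfl⟩
  · ext v
    simp only [Set.mem_iUnion, exists_prop]
    constructor
    · exact fun hv => ⟨_, ⟨v, hv, rfl⟩, mem_componentOf_self v⟩
    · rintro ⟨_, ⟨u, hu, rfl⟩, hv⟩
      change v ∈ componentOf G u at hv
      rcases hu with hu | ⟨a, ha, hu⟩
      · exact Or.inl (by rwa [componentOf_eq_of_mem hu] at hv)
      · exact Or.inr ⟨a, ha, by rwa [componentOf_eq_of_mem hu] at hv⟩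
  · rintro v (hv | hv)
    · exact Or.inl hv
    · exact Or.inr ⟨e, he', hv⟩
  · exact isFactorCritical_contract hm (fun v hv => Or.inl hv) ⟨k, mem_componentOf_self k⟩
      (fun v hv => (hXm v).2 hv) hcrit

/-! ### Consequences of minimality. -/

theorem not_mem_componentOf_of_not_mem {a b c : V} (hb : b ∉ componentOf G a)
    (hc : c ∈ componentOf G b) : c ∉ componentOf G a := by
  intro h
  apply hb
  rw [← componentOf_eq_of_mem h, componentOf_eq_of_mem hc]
  exact mem_componentOf_self b

/-- If an alternating path from `z` arrives at a vertex `x` of a minimal factor-component, at its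
first visit, by an edge outside the matching, then no alternating path from `z` arrives at `x` by
a matching edge. -/
theorem not_altReach_of_altChain [Finite V] (hm : IsMatchingPerm G m) {c x z : V} {A : List V}
    (hmin : ∀ v, Yields G (inducedSubgraph G (componentOf G v))
      (inducedSubgraph G (componentOf G c)) → v ∈ componentOf G c)
    (hx : x ∈ componentOf G c) (hA : ∀ a ∈ z :: A, a ∉ componentOf G c)
    (hc : AltChain G m (z :: A ++ [x])) (hs : AltSimple m (z :: A)) :
    ¬ AltReach G m z (m x) := by
  rintro ⟨R, hRc, hRs, hRz, hRl⟩
  obtain ⟨B, rfl⟩ := List.getLast?_eq_some_iff.1 hRl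
  -- Past `v` the first path avoids the second, so the second can be followed to `x` and the first
  -- back from `x` to `m v`.
  obtain ⟨A₁, v, A₂, hAv, hv, hA₂⟩ := exists_last (fun v => v ∈ B ++ [m x] ∨ m v ∈ B ++ [m x])
    (L := z :: A) ⟨z, by simp, Or.inl (List.mem_of_head? hRz)⟩
  have hmx : m x ∈ componentOf G c := hm.apply_mem_componentOf hx
  have hvc : v ∉ componentOf G c := hA v (by simp [hAv])
  have hmvc : m v ∉ componentOf G c := fun h => hvc (hm.apply_mem_componentOf_iff.1 h)
  rw [hAv] at hc hs
  have hrev : AltChain G m (m x :: (A₂.reverse.map m ++ [m v])) := by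
    have h1 : AltChain G m (A₁ ++ (v :: A₂ ++ [x])) := by simpa using hc
    simpa using h1.of_append_right.reverse hm.1
  have hsrev : AltSimple m (A₂.reverse.map m) :=
    (altSimple_cons.1 (altSimple_append.1 hs).2.1).2.reverse hm.1
  have key : ∀ u ∈ B ++ [m x], u ∉ componentOf G c → ∃ B₂,
      AltChain G m (u :: (B₂ ++ m x :: A₂.reverse.map m) ++ [m v]) ∧
        AltSimple m (u :: (B₂ ++ m x :: A₂.reverse.map m)) := by
    intro u hu huc
    have huB : u ∈ B := by
      rcases List.mem_append.1 hu with h | h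
      · exact h
      · exact (huc (by rwa [List.mem_singleton.1 h])).elim
    obtain ⟨B₁, B₂, rfl⟩ := List.append_of_mem huB
    refine ⟨B₂, ?_, ?_⟩
    · have h1 : AltChain G m (B₁ ++ (u :: B₂ ++ [m x])) := by simpa using hRc
      simpa using altChain_split.2 ⟨h1.of_append_right, hrev⟩
    · have h1 : AltSimple m (B₁ ++ (u :: B₂ ++ [m x])) := by simpa using hRs
      have h2 : AltSimple m ((u :: B₂ ++ [m x]) ++ A₂.reverse.map m) := by
        refine altSimple_append.2 ⟨(altSimple_append.1 h1).2.1, hsrev, fun p hp q hq => ?_⟩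
        have h3 := not_or.1 (hA₂ _ ((mem_map_reverse_iff hm.1).1 hq))
        rw [hm.1] at h3
        have hp' : p ∈ (B₁ ++ u :: B₂) ++ [m x] := by
          have := List.mem_append_right B₁ hp
          simpa using this
        constructor
        · rintro rfl
          exact h3.2 hp'
        · rintro rfl
          exact h3.1 hp'
      simpa using h2
  have hmxv : m x ∉ componentOf G (m v) := fun h => hmvc (by
    rw [← componentOf_eq_of_mem hmx, componentOf_eq_of_mem h]
    exact mem_componentOf_self _)
  rcases hv with hv | hv
  -- Both paths traverse the edge at `v` in the same direction: the result is an ear with both ends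
  -- at `m v`, passing through the minimal component.
  · obtain ⟨B₂, h1, h2⟩ := key v hv hvc
    have h3 := yields_of_ear hm (k := m v) (g₁ := m v) (g₂ := m v) (e := m x)
      (E := B₂ ++ m x :: A₂.reverse.map m) (mem_componentOf_self _) (mem_componentOf_self _)
      (by rwa [hm.1]) (altSimple_cons.1 h2).2 (by simp) hmxv
    rw [componentOf_eq_of_mem hmx] at h3
    exact hmvc (hmin _ h3)
  -- In opposite directions the result is an alternating circuit through `m v` and `m x`, which lie
  -- in different components.
  · obtain ⟨B₂, h1, h2⟩ := key (m v) hv hmvc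
    exact hmxv (mem_componentOf_of_closed hm h1 h2 (by simp))

theorem exists_not_altReach [Finite V] (hm : IsMatchingPerm G m) {a b : V}
    (hab : b ∉ componentOf G a)
    (hmin : ∀ v, Yields G (inducedSubgraph G (componentOf G v))
      (inducedSubgraph G (componentOf G a)) → v ∈ componentOf G a)
    (hnot : ¬ Yields G (inducedSubgraph G (componentOf G a))
      (inducedSubgraph G (componentOf G b))) :
    ∃ x ∈ componentOf G a, ∃ y ∈ componentOf G b,
      ¬ AltReach G m y x ∧ ¬ AltReach G m (m y) x := by
  by_contra hcon
  have hor : ∀ x ∈ componentOf G a, ∀ y ∈ componentOf G b,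
      AltReach G m y x ∨ AltReach G m (m y) x := by
    intro x hx y hy
    by_contra h
    exact hcon ⟨x, hx, y, hy, not_or.1 h⟩
  obtain ⟨y₀, hy₀, L, hLc, hLs, hLy, hLx⟩ : ∃ y ∈ componentOf G b, AltReach G m y a := by
    rcases hor a (mem_componentOf_self a) b (mem_componentOf_self b) with h | h
    · exact ⟨b, mem_componentOf_self b, h⟩
    · exact ⟨m b, hm.apply_mem_componentOf (mem_componentOf_self b), h⟩
  have hdisj : ∀ v ∈ componentOf G b, v ∉ componentOf G a :=
    fun v hv => not_mem_componentOf_of_not_mem hab hv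
  obtain ⟨L₁, x, L₂, rfl, hx, hL₁⟩ := exists_first (· ∈ componentOf G a) (L := L)
    ⟨a, List.mem_of_getLast? hLx, mem_componentOf_self a⟩
  have hy₀L : y₀ ∈ L₁ := by
    cases L₁ with
    | nil =>
      obtain rfl : x = y₀ := by simpa using hLy
      exact (hdisj x hy₀ hx).elim
    | cons c L₁ =>
      obtain rfl : c = y₀ := by simpa using hLy
      simp
  obtain ⟨L₃, z, A, rfl, hz, hAb⟩ := exists_last (· ∈ componentOf G b) (L := L₁) ⟨y₀, hy₀L, hy₀⟩
  have hPc : AltChain G m (z :: A ++ [x]) := by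
    have h1 : AltChain G m (L₃ ++ (z :: A ++ [x])) := by
      simpa using (altChain_split.1 hLc).1
    exact h1.of_append_right
  have hPs : AltSimple m (z :: A) := (altSimple_append.1 (altSimple_append.1 hLs).1).2.1
  have hzA := altSimple_cons.1 hPs
  have hAa : ∀ v ∈ z :: A, v ∉ componentOf G a := fun v hv => hL₁ v (List.mem_append_right _ hv)
  have hmx : m x ∈ componentOf G a := hm.apply_mem_componentOf hx
  have hmz : m z ∈ componentOf G b := hm.apply_mem_componentOf hz
  have hrev : AltChain G m (m x :: (A.reverse.map m ++ [m z])) := by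
    simpa using hPc.reverse hm.1
  have hR : AltReach G m (m z) (m x) :=
    (hor (m x) hmx z hz).resolve_left (not_altReach_of_altChain hm hmin hx hAa hPc hPs)
  obtain ⟨R, hRc, hRs, hRz, hRx⟩ := id hR
  obtain ⟨R₁, u, R₂, rfl, hu, hR₁⟩ := exists_first (· ∈ componentOf G a) (L := R)
    ⟨m x, List.mem_of_getLast? hRx, hmx⟩
  obtain ⟨B, rfl⟩ : ∃ B, R₁ = m z :: B := by
    cases R₁ with
    | nil =>
      obtain rfl : u = m z := by simpa using hRz
      exact (hdisj _ hmz hu).elim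
    | cons c B =>
      obtain rfl : c = m z := by simpa using hRz
      exact ⟨B, rfl⟩
  replace hRc := (altChain_split.1 hRc).1
  replace hRs := (altSimple_append.1 hRs).1
  by_cases hw : ∃ w ∈ B, w ∈ A ∨ m w ∈ A
  · obtain ⟨B₁, w, B₂, rfl, hw, hB₁⟩ := exists_first _ hw
    have hc₁ : AltChain G m ((m z :: B₁) ++ [w]) := by
      have h1 : AltChain G m ((m z :: B₁) ++ w :: (B₂ ++ [u])) := by simpa using hRc
      exact (altChain_split.1 h1).1
    have hs₁ : AltSimple m (m z :: B₁) := by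
      have h1 : AltSimple m ((m z :: B₁) ++ w :: B₂) := by simpa using hRs
      exact (altSimple_append.1 h1).1
    have hcross : ∀ p ∈ m z :: B₁, ∀ q ∈ A, p ≠ q ∧ p ≠ m q := by
      intro p hp q hq
      rcases List.mem_cons.1 hp with rfl | hp
      · refine ⟨fun h => (hzA.1 q hq).2 ?_, fun h => (hzA.1 q hq).1 (m.injective h)⟩
        rw [← h, hm.1]
      · have h1 := not_or.1 (hB₁ p hp)
        constructor
        · rintro rfl
          exact h1.1 hq
        · rintro rfl
          rw [hm.1] at h1
          exact h1.2 hq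
    rcases hw with hw | hw
    -- Same direction: following `A` from `w` gives a path from `m z` that arrives at `x` outside
    -- the matching, which excludes `hR`.
    · obtain ⟨A₁, A₂, rfl⟩ := List.append_of_mem hw
      refine not_altReach_of_altChain hm hmin hx (A := B₁ ++ w :: A₂) ?_ ?_ ?_ hR
      · intro v hv
        have hv' : v ∈ m z :: B₁ ∨ v ∈ w :: A₂ := by
          rw [← List.mem_append]
          simpa using hv
        rcases hv' with h | h
        · refine hR₁ v ?_
          have := List.mem_append_left (w :: B₂) h
          simpa using this
        · exact hAa v (List.mem_cons_of_mem _ (List.mem_append_right _ h))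
      · have h1 : AltChain G m ((z :: A₁) ++ (w :: (A₂ ++ [x]))) := by simpa using hPc
        simpa using altChain_split.2 ⟨hc₁, h1.of_append_right⟩
      · have h1 : AltSimple m ((m z :: B₁) ++ (w :: A₂)) :=
          altSimple_append.2 ⟨hs₁, (altSimple_append.1 hzA.2).2.1,
            fun p hp q hq => hcross p hp q (List.mem_append_right _ hq)⟩
        simpa using h1
    -- Opposite direction: following `A` backwards from `w` closes an alternating circuit at `m z`,
    -- so `A` would return to the component of `z` after its last visit there.
    · obtain ⟨A₁, A₂, rfl⟩ := List.append_of_mem hw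
      have h1 : AltChain G m (w :: (A₁.reverse.map m ++ [m z])) := by
        have h2 : AltChain G m ((z :: A₁ ++ [m w]) ++ (A₂ ++ [x])) := by simpa using hPc
        simpa [hm.1] using h2.of_append_left.reverse hm.1
      have h2 : AltSimple m ((A₁ ++ [m w]).reverse.map m) := by
        have h3 : AltSimple m ((A₁ ++ [m w]) ++ A₂) := by simpa using hzA.2
        exact (altSimple_append.1 h3).1.reverse hm.1
      have h3 : AltSimple m ((m z :: B₁) ++ (A₁ ++ [m w]).reverse.map m) := by
        refine altSimple_append.2 ⟨hs₁, h2, fun p hp q hq => ?_⟩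
        have hq' : m q ∈ A₁ ++ m w :: A₂ := by
          have := List.mem_append_left A₂ ((mem_map_reverse_iff hm.1).1 hq)
          simpa using this
        have h4 := hcross p hp _ hq'
        rw [hm.1] at h4
        exact h4.symm
      have h4 := mem_componentOf_of_closed hm (c := m z) (L := B₁ ++ w :: A₁.reverse.map m)
        (by simpa using altChain_split.2 ⟨hc₁, h1⟩) (by simpa [hm.1] using h3) (v := w) (by simp)
      rw [componentOf_eq_of_mem hmz] at h4
      exact hAb _ hw (hm.apply_mem_componentOf h4)
  -- Disjoint paths: from `x` back along `A` to `m z`, across to `z` and on to `u` is an ear of the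
  -- first component through the second.
  · have h1 : AltChain G m (m x :: (A.reverse.map m ++ m z :: B) ++ [u]) := by
      have h2 : AltChain G m ((m x :: A.reverse.map m) ++ [m z]) := by simpa using hrev
      have h3 : AltChain G m (m z :: (B ++ [u])) := by simpa using hRc
      simpa using altChain_split.2 ⟨h2, h3⟩
    have h2 : AltSimple m (A.reverse.map m ++ m z :: B) := by
      refine altSimple_append.2 ⟨hzA.2.reverse hm.1, hRs, fun p hp q hq => ?_⟩
      have hp' := (mem_map_reverse_iff hm.1).1 hp
      rcases List.mem_cons.1 hq with rfl | hq
      · have h3 := hzA.1 _ hp'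
        rw [hm.1] at h3
        refine ⟨fun h => h3.1 ?_, fun h => h3.2 ?_⟩
        · rw [h, hm.1]
        · rw [h, hm.1]
      · have h3 : ¬ (q ∈ A ∨ m q ∈ A) := fun h => hw ⟨q, hq, h⟩
        constructor
        · rintro rfl
          exact h3 (Or.inr hp')
        · rintro rfl
          rw [hm.1] at hp'
          exact h3 (Or.inl hp')
    have h3 := yields_of_ear hm hx hu h1 h2 (e := m z) (by simp) (hdisj _ hmz)
    rw [componentOf_eq_of_mem hmz] at h3
    exact hnot h3

/-! ### Adding the edges. -/

theorem yields_refl [Finite V] (hm : IsMatchingPerm G m) (a : V) :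
    Yields G (inducedSubgraph G (componentOf G a)) (inducedSubgraph G (componentOf G a)) := by
  refine ⟨componentOf G a, ⟨{inducedSubgraph G (componentOf G a)}, ?_, by simp, ?_⟩, ?_, ?_⟩
  · rintro _ rfl
    exact mem_factorComponents_iff.2 ⟨a, rfl⟩
  · simp [inducedSubgraph]
  · rintro v (hv | hv)
    · exact hv
    · exact hv
  · exact isFactorCritical_contract hm (H := componentOf G a) subset_rfl
      ⟨a, mem_componentOf_self a⟩ (fun v hv => (hv.2 hv.1).elim) (fun v hv => (hv.2 hv.1).elim)

/-- The excluded paths keep the pairs {x, y} and {x, m y} out of every perfect matching of the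
enlarged graph, so the perfect matchings do not change, while x, y, m y, x becomes an ear. -/
theorem factorComponents_addEdges_and_yields [Finite V] (hm : IsMatchingPerm G m) {a b x y : V}
    (hab : b ∉ componentOf G a) (hx : x ∈ componentOf G a) (hy : y ∈ componentOf G b)
    (h₁ : ¬ AltReach G m y (m x)) (h₂ : ¬ AltReach G m (m y) (m x)) {F : Set (Sym2 V)}
    (hF : ∀ e ∈ F, e = s(x, y) ∨ e = s(x, m y)) (hxy : (addEdges G F).Adj x y)
    (hxmy : (addEdges G F).Adj x (m y)) :
    factorComponents (addEdges G F) = factorComponents G ∧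
      Yields (addEdges G F) (inducedSubgraph G (componentOf G a))
        (inducedSubgraph G (componentOf G b)) := by
  have hle : ∀ u v, G.Adj u v → (addEdges G F).Adj u v := fun u v h => Or.inl h
  have hadj : ∀ u v, (addEdges G F).Adj u v → G.Adj u v ∨
      (u = x ∧ v = y ∨ u = y ∧ v = x) ∨ (u = x ∧ v = m y ∨ u = m y ∧ v = x) := by
    rintro u v (h | h)
    · exact Or.inl h
    · right
      rw [fromEdgeSet_adj] at h
      simpa only [Sym2.eq_iff] using hF _ h.1
  have hmy : m y ∈ componentOf G b := hm.apply_mem_componentOf hy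
  have hm' : IsMatchingPerm (addEdges G F) m := ⟨hm.1, fun v => hle _ _ (hm.2 v)⟩
  have hpm : ∀ n : Equiv.Perm V, IsMatchingPerm (addEdges G F) n → IsMatchingPerm G n := by
    intro n hn
    have hnot : ∀ t ∈ componentOf G b, n x = t → (t = y ∨ t = m y) →
        (∀ v, v ≠ x → v ≠ t → G.Adj v (n v)) → False := by
      intro t ht hxt hty hv
      have hxt' : x ≠ t := by
        rintro rfl
        exact not_mem_componentOf_of_not_mem hab ht hx
      have h := (altReach_of_perm hm hn.1 hxt hxt' hv).reverse hm.1
      rw [hm.1] at h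
      rcases hty with rfl | rfl
      · exact h₁ h
      · exact h₂ h
    -- Every new edge contains `x`, so only the `n`-edge at `x` can be new.
    have hnx : ∀ v, v ≠ x → v ≠ n x → G.Adj v (n v) := by
      intro v hvx hvn
      rcases hadj _ _ (hn.2 v) with h | (⟨h, -⟩ | ⟨-, h⟩) | (⟨h, -⟩ | ⟨-, h⟩)
      · exact h
      · exact (hvx h).elim
      · exact (hvn (by rw [← h, hn.1])).elim
      · exact (hvx h).elim
      · exact (hvn (by rw [← h, hn.1])).elim
    have hx' : G.Adj x (n x) := by
      rcases hadj _ _ (hn.2 x) with h | (⟨-, h⟩ | ⟨h, -⟩) | (⟨-, h⟩ | ⟨h, -⟩)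
      · exact h
      · exact (hnot y hy h (Or.inl rfl) (h ▸ hnx)).elim
      · exact (not_mem_componentOf_of_not_mem hab hy (h ▸ hx)).elim
      · exact (hnot (m y) hmy h (Or.inr rfl) (h ▸ hnx)).elim
      · exact (not_mem_componentOf_of_not_mem hab hmy (h ▸ hx)).elim
    refine ⟨hn.1, fun v => ?_⟩
    by_cases hvx : v = x
    · rw [hvx]
      exact hx'
    by_cases hvn : v = n x
    · rw [hvn, hn.1]
      exact hx'.symm
    exact hnx v hvx hvn
  have hallowed : allowedGraph (addEdges G F) = allowedGraph G := by
    ext u v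
    rw [allowedGraph_adj_iff hm'.isFactorizable, allowedGraph_adj_iff hm.isFactorizable]
    exact ⟨fun ⟨n, hn, h⟩ => ⟨n, hpm n hn, h⟩,
      fun ⟨n, hn, h⟩ => ⟨n, ⟨hn.1, fun v => hle _ _ (hn.2 v)⟩, h⟩⟩
  have hcomp : componentOf (addEdges G F) = componentOf G := by
    unfold componentOf
    rw [hallowed]
  have hind : ∀ v, inducedSubgraph (addEdges G F) (componentOf G v) =
      inducedSubgraph G (componentOf G v) := by
    intro v
    have hxt : ∀ t ∈ componentOf G b, x ∈ componentOf G v → t ∉ componentOf G v := by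
      intro t ht hxv
      rw [← componentOf_eq_of_mem hxv, componentOf_eq_of_mem hx]
      exact not_mem_componentOf_of_not_mem hab ht
    refine Subgraph.ext rfl ?_
    ext u w
    refine ⟨fun ⟨hu, hw, h⟩ => ⟨hu, hw, ?_⟩, fun ⟨hu, hw, h⟩ => ⟨hu, hw, hle _ _ h⟩⟩
    rcases hadj _ _ h with h | (⟨rfl, rfl⟩ | ⟨rfl, rfl⟩) | (⟨rfl, rfl⟩ | ⟨rfl, rfl⟩)
    · exact h
    · exact (hxt _ hy hu hw).elim
    · exact (hxt _ hy hw hu).elim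
    · exact (hxt _ hmy hu hw).elim
    · exact (hxt _ hmy hw hu).elim
  constructor
  · ext H
    rw [mem_factorComponents_iff, mem_factorComponents_iff]
    simp only [hcomp, hind]
  · have hc : AltChain (addEdges G F) m (m x :: [y] ++ [x]) := by
      refine List.isChain_cons_cons.2 ⟨?_, List.isChain_cons_cons.2
        ⟨hxmy.symm, List.isChain_singleton _⟩⟩
      rwa [hm.1]
    have h := yields_of_ear hm' (k := a) (e := y) (by rwa [hcomp]) (by rwa [hcomp]) hc
      (List.pairwise_singleton _ _) (by simp)
      (by rw [hcomp]; exact not_mem_componentOf_of_not_mem hab hy)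
    rwa [hcomp, hind, hind, componentOf_eq_of_mem hy] at h

end Basilica

open Basilica in
theorem mainTheorem6 {V : Type*} [Finite V] (G : SimpleGraph V)
    (hG : Basilica.IsFactorizable G)
    (G₁ G₂ : (⊤ : SimpleGraph V).Subgraph)
    (h₁ : G₁ ∈ Basilica.factorComponents G) (h₂ : G₂ ∈ Basilica.factorComponents G)
    (hnot : ¬ Basilica.Yields G G₁ G₂)
    (hmin : Basilica.IsMinimalComponent G G₁) :
    ∃ e f : Sym2 V,
      Basilica.IsComplementEdgeBetween G G₁ G₂ e ∧
      Basilica.IsComplementEdgeBetween G G₁ G₂ f ∧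
      Basilica.factorComponents (Basilica.addEdges G {e, f}) = Basilica.factorComponents G ∧
      Basilica.Yields (Basilica.addEdges G {e, f}) G₁ G₂ := by
  obtain ⟨M, hM⟩ := hG
  obtain ⟨m, hm, -⟩ := exists_isMatchingPerm_of_isPerfectMatching hM
  obtain ⟨a, rfl⟩ := mem_factorComponents_iff.1 h₁
  obtain ⟨b, rfl⟩ := mem_factorComponents_iff.1 h₂
  have hab : b ∉ componentOf G a := by
    intro h
    rw [componentOf_eq_of_mem h] at hnot
    exact hnot (yields_refl hm a)
  obtain ⟨x', hx', y, hy, hy₁, hy₂⟩ := exists_not_altReach hm hab (fun v hv => by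
    have h : componentOf G v = componentOf G a :=
      congrArg SimpleGraph.Subgraph.verts (hmin.2 _ (mem_factorComponents_iff.2 ⟨v, rfl⟩) hv)
    rw [← h]
    exact mem_componentOf_self v) hnot
  -- The excluded paths end at `m x'`, so this is the vertex at which the new edges are attached.
  obtain ⟨x, rfl⟩ : ∃ x, m x = x' := ⟨m x', hm.1 x'⟩
  have hx : x ∈ componentOf G a := hm.apply_mem_componentOf_iff.1 hx'
  have hmy : m y ∈ componentOf G b := hm.apply_mem_componentOf hy
  have hne : ∀ t ∈ componentOf G b, x ≠ t := by
    rintro t ht rfl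
    exact not_mem_componentOf_of_not_mem hab ht hx
  have hedge : ∀ t ∈ componentOf G b, ¬ G.Adj x t → IsComplementEdgeBetween G
      (inducedSubgraph G (componentOf G a)) (inducedSubgraph G (componentOf G b)) s(x, t) :=
    fun t ht h => ⟨⟨hne t ht, h⟩, x, hx, t, ht, rfl⟩
  have hnew : ∀ (F : Set (Sym2 V)) (t : V), t ∈ componentOf G b → s(x, t) ∈ F →
      (addEdges G F).Adj x t := fun F t ht h =>
    Or.inr ((SimpleGraph.fromEdgeSet_adj _).2 ⟨h, hne t ht⟩)
  by_cases hxy : G.Adj x y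
  · by_cases hxmy : G.Adj x (m y)
    -- If both edges were already present, the ear would exist in `G` itself, contrary to `hnot`.
    · have h := (factorComponents_addEdges_and_yields hm hab hx hy hy₁ hy₂ (F := ∅) (by simp)
        (Or.inl hxy) (Or.inl hxmy)).2
      have hG : addEdges G ∅ = G := by simp [addEdges]
      rw [hG] at h
      exact (hnot h).elim
    · exact ⟨s(x, m y), s(x, m y), hedge _ hmy hxmy, hedge _ hmy hxmy,
        factorComponents_addEdges_and_yields hm hab hx hy hy₁ hy₂ (by simp) (Or.inl hxy)
          (hnew _ _ hmy (by simp))⟩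
  · by_cases hxmy : G.Adj x (m y)
    · exact ⟨s(x, y), s(x, y), hedge _ hy hxy, hedge _ hy hxy,
        factorComponents_addEdges_and_yields hm hab hx hy hy₁ hy₂ (by simp)
          (hnew _ _ hy (by simp)) (Or.inl hxmy)⟩
    · exact ⟨s(x, y), s(x, m y), hedge _ hy hxy, hedge _ hmy hxmy,
        factorComponents_addEdges_and_yields hm hab hx hy hy₁ hy₂ (by simp)
          (hnew _ _ hy (by simp)) (hnew _ _ hmy (by simp))⟩
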